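/- **Conventions.** Let $k$ be a field. A Brauer configuration $\mathscr M=(M,\mathscr M_1,\mu,\mathcal O)$ consists of a finite set $M$ of vertices, a finite family $\mathscr M_1=\{(U_1,f_1),\dots,(U_m,f_m)\}$ of multisets of vertices (polygons), where $f_i(v)$ is the number of times that $v$ occurs in the $i$th polygon, such that each polygon has at least two elements counted with repetition and every vertex occurs in some polygon, a multiplicity function $\mu:M\to\{1,2,\dots\}$, and an orientation $\mathcal O$, that is, for each vertex $v$ a circular order on its $val(v)=\sum_i f_i(v)$ occurrences in polygons. It is assumed that $\mu(v)\,val(v)>1$ for all $v\in M$. The Brauer quiver $Q_{\mathscr M}$ has the polygons as vertices, and one arrow for each occurrence of each vertex, from the polygon of this occurrence to the polygon of the next occurrence of the same vertex in its circular order (if $val(v)=1$, this is a loop). The special cycle of $v$ starting at an occurrence of $v$ is the product of the $val(v)$ arrows met when going once around the circular order of $v$ from there. The Brauer configuration algebra $\Lambda_{\mathscr M}$ is the path algebra $kQ_{\mathscr M}$ modulo the two-sided ideal generated by * $C^{\mu(v)}-D^{\mu(w)}$, where $C$ and $D$ are special cycles of vertices $v$ and $w$ starting at occurrences in the same polygon;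 * $C^{\mu(v)}a$, where $C$ is a special cycle of $v$ and $a$ is its first arrow; * $ab$, where $a,b$ are composable arrows such that $b$ is not the arrow following $a$ in the circular order of some vertex. $\mathscr M$ is connected if $m\ge 1$ and any two polygons are joined by a chain of polygons in which consecutive ones share a vertex. **Proposition 3.4.** Let $\mathscr M=(M,\mathscr M_1,\mu,\mathcal O)$ be a connected Brauer configuration with $m$ polygons, $\mathscr M_1=\{(U_1,f_1),\dots,(U_m,f_m)\}$, such that $f_i(u)=1$ for every $u\in U_i$, $1\le i\le m$. Suppose that $\mu(v)=2$ for each vertex $v$ with $val(v)=1$ and $\mu(v)=1$ for each other vertex, and that exactly $n$ vertices $v$ satisfy $val(v)=1$. Then the center of $\Lambda_{\mathscr M}$ satisfies $$\dim_k Z(\Lambda_{\mathscr M})=m+n+1.$$ -/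

import Mathlib

/-! ### Path algebras -/

section PathAlgebra

/-- The path algebra `kQ` of a quiver `Q` with finitely many vertices. Its underlying `k`-vector
space has the set of all paths of `Q` as a basis: an element assigns to each pair of vertices
`i, j` a finitely supported `k`-linear combination of the paths from `i` to `j`. -/
def PathAlgebra (k Q : Type*) [Field k] [Quiver Q] :=
  ∀ i j : Q, Quiver.Path i j →₀ k

namespace PathAlgebra

variable {k Q : Type*} [Field k] [Quiver Q]

noncomputable instance : AddCommGroup (PathAlgebra k Q) :=
  inferInstanceAs (AddCommGroup (∀ i j : Q, Quiver.Path i j →₀ k))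

noncomputable instance : Module k (PathAlgebra k Q) :=
  inferInstanceAs (Module k (∀ i j : Q, Quiver.Path i j →₀ k))

/-- Concatenation of paths (first `p`, then `q`), extended bilinearly. -/
noncomputable def concat (i l j : Q) :
    (Quiver.Path i l →₀ k) →ₗ[k] (Quiver.Path l j →₀ k) →ₗ[k] (Quiver.Path i j →₀ k) :=
  Finsupp.lsum k fun p : Quiver.Path i l =>
    LinearMap.toSpanSingleton k _ (Finsupp.lmapDomain k k fun q : Quiver.Path l j => p.comp q)

theorem concat_single {i l j : Q} (p : Quiver.Path i l) (q : Quiver.Path l j) (a b : k) :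
    concat i l j (Finsupp.single p a) (Finsupp.single q b)
      = Finsupp.single (p.comp q) (a * b) := by
  simp [concat]

theorem concat_assoc {i l m j : Q} (f : Quiver.Path i l →₀ k) (g : Quiver.Path l m →₀ k)
    (h : Quiver.Path m j →₀ k) :
    concat i m j (concat i l m f g) h = concat i l j f (concat l m j g h) := by
  induction f using Finsupp.induction_linear with
  | zero => simp
  | add f₁ f₂ h₁ h₂ => simp [h₁, h₂]
  | single p a =>
    induction g using Finsupp.induction_linear with
    | zero => simp
    | add f₁ f₂ h₁ h₂ => simp [h₁, h₂]
    | single q b =>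
      induction h using Finsupp.induction_linear with
      | zero => simp
      | add f₁ f₂ h₁ h₂ => simp [h₁, h₂]
      | single r c => simp only [concat_single, mul_assoc, Quiver.Path.comp_assoc]

theorem nil_concat {i j : Q} (f : Quiver.Path i j →₀ k) :
    concat i i j (Finsupp.single Quiver.Path.nil 1) f = f := by
  induction f using Finsupp.induction_linear with
  | zero => simp
  | add f₁ f₂ h₁ h₂ => simp [h₁, h₂]
  | single p a => simp [concat_single]

theorem concat_nil {i j : Q} (f : Quiver.Path i j →₀ k) :
    concat i j j f (Finsupp.single Quiver.Path.nil 1) = f := by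
  induction f using Finsupp.induction_linear with
  | zero => simp
  | add f₁ f₂ h₁ h₂ => simp [h₁, h₂]
  | single p a => simp [concat_single]

theorem add_apply (f g : PathAlgebra k Q) (i j : Q) : (f + g) i j = f i j + g i j := rfl

theorem zero_apply (i j : Q) : (0 : PathAlgebra k Q) i j = 0 := rfl

theorem smul_apply (c : k) (f : PathAlgebra k Q) (i j : Q) : (c • f) i j = c • f i j := rfl

section

variable [DecidableEq Q]

/-- The basis element of `kQ` given by a path. -/
noncomputable def ofPath (k : Type*) [Field k] {i j : Q} (p : Quiver.Path i j) :
    PathAlgebra k Q :=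
  Pi.single i (Pi.single j (Finsupp.single p 1))

/-- The identity is the sum of all paths of length `0`. -/
noncomputable instance : One (PathAlgebra k Q) :=
  ⟨fun i => Pi.single i (Finsupp.single Quiver.Path.nil 1)⟩

theorem one_apply (i : Q) :
    (1 : PathAlgebra k Q) i = Pi.single i (Finsupp.single Quiver.Path.nil 1) := rfl

theorem one_apply_same (i : Q) :
    (1 : PathAlgebra k Q) i i = Finsupp.single Quiver.Path.nil 1 := by
  simp [one_apply]

theorem one_apply_ne {i j : Q} (h : i ≠ j) : (1 : PathAlgebra k Q) i j = 0 := by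
  simp [one_apply, Pi.single_eq_of_ne h.symm]

end

variable [Fintype Q]

/-- The product: concatenate composable paths, the product of non-composable paths being `0`. -/
noncomputable instance : Mul (PathAlgebra k Q) :=
  ⟨fun f g i j => ∑ l, concat i l j (f i l) (g l j)⟩

theorem mul_apply (f g : PathAlgebra k Q) (i j : Q) :
    (f * g) i j = ∑ l, concat i l j (f i l) (g l j) := rfl

variable [DecidableEq Q]

noncomputable instance : Ring (PathAlgebra k Q) :=
  { (inferInstance : AddCommGroup (PathAlgebra k Q)),
    (inferInstance : Mul (PathAlgebra k Q)),
    (inferInstance : One (PathAlgebra k Q)) with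
    left_distrib := fun f g h => by
      funext i j
      simp [mul_apply, add_apply, Finset.sum_add_distrib]
    right_distrib := fun f g h => by
      funext i j
      simp [mul_apply, add_apply, Finset.sum_add_distrib]
    zero_mul := fun f => by
      funext i j
      simp [mul_apply, zero_apply]
    mul_zero := fun f => by
      funext i j
      simp [mul_apply, zero_apply]
    mul_assoc := fun f g h => by
      funext i j
      simp only [mul_apply, map_sum, LinearMap.sum_apply, concat_assoc]
      exact Finset.sum_comm
    one_mul := fun f => by
      funext i j
      rw [mul_apply, Finset.sum_eq_single i, one_apply_same, nil_concat]
      · intro l _ hl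
        simp [one_apply_ne hl.symm]
      · simp
    mul_one := fun f => by
      funext i j
      rw [mul_apply, Finset.sum_eq_single j, one_apply_same, concat_nil]
      · intro l _ hl
        simp [one_apply_ne hl]
      · simp }

noncomputable instance : Algebra k (PathAlgebra k Q) :=
  Algebra.ofModule
    (fun c f g => by
      funext i j
      simp [mul_apply, smul_apply, Finset.smul_sum])
    (fun c f g => by
      funext i j
      simp [mul_apply, smul_apply, Finset.smul_sum])

end PathAlgebra

end PathAlgebra

/-! ### Brauer configurations -/

/-- The occurrences of the vertex `v` in the polygons of a family of multisets with frequency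
functions `f i`: the polygon `i` contributes `f i v` copies of itself. -/
abbrev VertexOccurrence {V P : Type*} (f : P → V → ℕ) (v : V) := Σ i : P, Fin (f i v)

/-- A Brauer configuration with vertex set `V` and polygons indexed by `P`. -/
structure BrauerConfiguration (V P : Type*) [Fintype V] [Fintype P] where
  /-- `freq i v` is the number of times that the vertex `v` occurs in the polygon `i`. -/
  freq : P → V → ℕ
  /-- Every vertex lies in some polygon. -/
  covers : ∀ v, ∃ i, 0 < freq i v
  /-- Every polygon has at least two vertices, counted with repetition. -/
  one_lt_size : ∀ i, 1 < ∑ v, freq i v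
  /-- The multiplicity function (not to be confused with the frequencies). -/
  mult : V → ℕ
  mult_pos : ∀ v, 0 < mult v
  /-- All vertices are non-truncated: multiplicity times valency is greater than `1`. -/
  nontruncated : ∀ v, 1 < mult v * ∑ i, freq i v
  /-- The orientation: a circular order on the occurrences of each vertex, given by its
  successor map. -/
  next : ∀ v, Equiv.Perm (VertexOccurrence freq v)
  /-- The successor map of a vertex runs through all its occurrences in one cycle. -/
  next_cyclic : ∀ v (x y : VertexOccurrence freq v), (next v).SameCycle x y

namespace BrauerConfiguration

variable {V P : Type*} [Fintype V] [Fintype P]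

/-- The valency of a vertex: the number of its occurrences in all the polygons. -/
def val (Γ : BrauerConfiguration V P) (v : V) : ℕ := ∑ i, Γ.freq i v

/-- Connectedness: there is a polygon, and any two polygons are joined by a chain of polygons in
which consecutive ones share a vertex. -/
def Connected (Γ : BrauerConfiguration V P) : Prop :=
  (SimpleGraph.fromRel fun i j : P => ∃ v, 0 < Γ.freq i v ∧ 0 < Γ.freq j v).Connected

/-- The occurrences of all vertices in all polygons. -/
abbrev Occurrence (Γ : BrauerConfiguration V P) := Σ v : V, VertexOccurrence Γ.freq v

/-- The polygon in which an occurrence takes place. -/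
def polygon (Γ : BrauerConfiguration V P) (x : Γ.Occurrence) : P := x.2.1

/-- The next occurrence of the same vertex in the circular order. -/
def succ (Γ : BrauerConfiguration V P) (x : Γ.Occurrence) : Γ.Occurrence :=
  ⟨x.1, Γ.next x.1 x.2⟩

/-- The vertex set of the Brauer quiver: the set of polygons. -/
def QuiverVertex (_Γ : BrauerConfiguration V P) : Type _ := P

instance (Γ : BrauerConfiguration V P) : Fintype Γ.QuiverVertex := inferInstanceAs (Fintype P)

instance (Γ : BrauerConfiguration V P) [DecidableEq P] : DecidableEq Γ.QuiverVertex :=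
  inferInstanceAs (DecidableEq P)

/-- The Brauer quiver: each occurrence `x` of a vertex gives one arrow, from the polygon of `x` to
the polygon of the next occurrence of the same vertex. -/
instance (Γ : BrauerConfiguration V P) : Quiver Γ.QuiverVertex where
  Hom i j := {x : Γ.Occurrence // Γ.polygon x = i ∧ Γ.polygon (Γ.succ x) = j}

variable [DecidableEq P] (k : Type*) [Field k]

/-- The arrow of the Brauer quiver that starts at the occurrence `x`, as an element of the path
algebra. -/
noncomputable def arrow (Γ : BrauerConfiguration V P) (x : Γ.Occurrence) :
    PathAlgebra k Γ.QuiverVertex :=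
  let a : (show Γ.QuiverVertex from Γ.polygon x) ⟶
      (show Γ.QuiverVertex from Γ.polygon (Γ.succ x)) := ⟨x, rfl, rfl⟩
  PathAlgebra.ofPath k a.toPath

/-- The special cycle starting at the occurrence `x` of a vertex `v`: the product of the `val v`
arrows met when going once around the circular order of `v`. -/
noncomputable def specialCycle (Γ : BrauerConfiguration V P) (x : Γ.Occurrence) :
    PathAlgebra k Γ.QuiverVertex :=
  ((List.range (Γ.val x.1)).map fun n => Γ.arrow k (Γ.succ^[n] x)).prod

/-- The relations that define the Brauer configuration algebra. -/
inductive IsRelation (Γ : BrauerConfiguration V P) : PathAlgebra k Γ.QuiverVertex → Prop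
  /-- `C ^ μ(v) - C' ^ μ(w)` for the special cycles at occurrences of vertices `v`, `w` in one and
  the same polygon. -/
  | cycle_sub_cycle (x y : Γ.Occurrence) (h : Γ.polygon x = Γ.polygon y) :
      IsRelation Γ (Γ.specialCycle k x ^ Γ.mult x.1 - Γ.specialCycle k y ^ Γ.mult y.1)
  /-- `C ^ μ(v) a`, where `a` is the first arrow of the special cycle `C` of the vertex `v`. -/
  | cycle_mul_arrow (x : Γ.Occurrence) :
      IsRelation Γ (Γ.specialCycle k x ^ Γ.mult x.1 * Γ.arrow k x)
  /-- `a b` for composable arrows `a`, `b` such that `b` does not follow `a` in a special cycle; in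
  particular for composable arrows that belong to different vertices of the configuration. -/
  | arrow_mul_arrow (x y : Γ.Occurrence) (h : Γ.polygon (Γ.succ x) = Γ.polygon y)
      (hne : y ≠ Γ.succ x) :
      IsRelation Γ (Γ.arrow k x * Γ.arrow k y)

/-- The Brauer configuration algebra: the path algebra of the Brauer quiver modulo the two-sided
ideal generated by the relations. -/
abbrev BrauerAlgebra (Γ : BrauerConfiguration V P) : Type _ :=
  (TwoSidedIdeal.span {r | Γ.IsRelation k r}).ringCon.Quotient

end BrauerConfiguration

/-!
The products of at most `μ(v) val(v)` consecutive arrows around a vertex `v`, together with the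
trivial paths, span `Λ`, the products of maximal length depending only on the polygon in which they
start. Letting the arrows act by left multiplication on the vector space with these normal forms as
a basis gives a representation of `kQ` that kills the relations, so the normal forms are linearly
independent and `Λ` can be studied through coordinates.

Comparing the coordinates of `za` and `az` for an arrow `a` shows that the coordinates of a central
element `z` at trivial paths all agree by connectedness, that those at proper powers of special
cycles are invariant under rotation, and that those at other products of consecutive arrows vanish,
except where the product becomes maximal when multiplied by a loop. The coordinates at the maximal
products are unrestricted. If no polygon contains a vertex twice, a loop only arises when
`val(v) = 1`, where it is itself a proper power of a special cycle, so the dimension of the center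
is `1 + m + ∑ (μ(v) - 1)`.
-/

namespace PathAlgebra

variable {k Q : Type*} [Field k] [Quiver Q]

section EvalPath

variable {A : Type*} [Ring A] (e : Q → A) (a : ∀ {i j : Q}, (i ⟶ j) → A)

/-- The value of a path when the trivial paths are sent to `e` and the arrows to `a`. -/
def evalPath {i : Q} : ∀ {j : Q}, Quiver.Path i j → A
  | _, .nil => e i
  | _, .cons p f => evalPath p * a f

variable {e a}

theorem evalPath_mul_target (he : OrthogonalIdempotents e)
    (har : ∀ {i j : Q} (f : i ⟶ j), a f * e j = a f) {i j : Q} (p : Quiver.Path i j) :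
    evalPath e a p * e j = evalPath e a p := by
  cases p with
  | nil => exact he.idem i
  | cons p f => rw [evalPath, mul_assoc, har]

theorem source_mul_evalPath (he : OrthogonalIdempotents e) {i j : Q}
    (p : Quiver.Path i j) : e i * evalPath e a p = evalPath e a p := by
  induction p with
  | nil => exact he.idem i
  | cons p f ih => rw [evalPath, ← mul_assoc, ih]

theorem evalPath_comp (he : OrthogonalIdempotents e)
    (har : ∀ {i j : Q} (f : i ⟶ j), a f * e j = a f) {i l j : Q} (p : Quiver.Path i l)
    (q : Quiver.Path l j) : evalPath e a (p.comp q) = evalPath e a p * evalPath e a q := by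
  induction q with
  | nil => exact (evalPath_mul_target he har p).symm
  | cons q f ih => rw [Quiver.Path.comp_cons, evalPath, ih, evalPath, mul_assoc]

theorem evalPath_mul_evalPath_of_ne (he : OrthogonalIdempotents e)
    (har : ∀ {i j : Q} (f : i ⟶ j), a f * e j = a f) {i l l' j : Q} (p : Quiver.Path i l)
    (q : Quiver.Path l' j) (h : l ≠ l') : evalPath e a p * evalPath e a q = 0 := by
  rw [← evalPath_mul_target he har p, ← source_mul_evalPath he q, mul_assoc, ← mul_assoc (e l),
    he.ortho h, zero_mul, mul_zero]

end EvalPath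

variable [DecidableEq Q]

theorem ofPath_apply_self {i j : Q} (p : Quiver.Path i j) :
    ofPath k p i j = Finsupp.single p 1 := by
  simp [ofPath]

theorem ofPath_apply_of_ne_left {i j a : Q} (p : Quiver.Path i j) (h : a ≠ i) (b : Q) :
    ofPath k p a b = 0 := by
  simp [ofPath, Pi.single_eq_of_ne h]

theorem ofPath_apply_of_ne_right {i j b : Q} (p : Quiver.Path i j) (h : b ≠ j) (a : Q) :
    ofPath k p a b = 0 := by
  obtain rfl | ha := eq_or_ne a i
  · simp [ofPath, Pi.single_eq_of_ne h]
  · exact ofPath_apply_of_ne_left p ha b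

variable [Fintype Q]

theorem ofPath_mul_ofPath {i l j : Q} (p : Quiver.Path i l) (q : Quiver.Path l j) :
    ofPath k p * ofPath k q = ofPath k (p.comp q) := by
  funext a b
  rw [mul_apply]
  obtain rfl | ha := eq_or_ne a i
  · obtain rfl | hb := eq_or_ne b j
    · rw [Fintype.sum_eq_single l fun c hc => by simp [ofPath_apply_of_ne_left q hc]]
      simp [ofPath_apply_self, concat_single]
    · simp [ofPath_apply_of_ne_right _ hb]
  · simp [ofPath_apply_of_ne_left _ ha]

theorem ofPath_mul_ofPath_of_ne {i l l' j : Q} (p : Quiver.Path i l) (q : Quiver.Path l' j)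
    (h : l ≠ l') : ofPath k p * ofPath k q = 0 := by
  funext a b
  refine Finset.sum_eq_zero fun c _ => ?_
  obtain rfl | hc := eq_or_ne c l
  · simp [ofPath_apply_of_ne_left q h]
  · simp [ofPath_apply_of_ne_right p hc]

/-- The trivial path at a vertex, an idempotent of the path algebra. -/
noncomputable def idem (k : Type*) [Field k] (i : Q) : PathAlgebra k Q :=
  ofPath k (Quiver.Path.nil : Quiver.Path i i)

theorem completeOrthogonalIdempotents_idem :
    CompleteOrthogonalIdempotents (idem k : Q → PathAlgebra k Q) where
  idem _ := ofPath_mul_ofPath _ _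
  ortho _ _ h := ofPath_mul_ofPath_of_ne _ _ h
  complete := Finset.univ_sum_single (M := fun i : Q => ∀ j : Q, Quiver.Path i j →₀ k)
    (1 : PathAlgebra k Q)

/-- The inclusion of the span of the paths from `i` to `j`. -/
noncomputable def ofHom (k : Type*) [Field k] (i j : Q) :
    (Quiver.Path i j →₀ k) →ₗ[k] PathAlgebra k Q :=
  (LinearMap.single k (fun i : Q => ∀ j : Q, Quiver.Path i j →₀ k) i).comp
    (LinearMap.single k (fun j : Q => Quiver.Path i j →₀ k) j)

theorem sum_ofHom (f : PathAlgebra k Q) : ∑ i, ∑ j, ofHom k i j (f i j) = f := by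
  have row (i : Q) : ∑ j, ofHom k i j (f i j)
      = LinearMap.single k (fun i : Q => ∀ j : Q, Quiver.Path i j →₀ k) i (f i) := by
    rw [← Finset.univ_sum_single (f i), map_sum, Finset.univ_sum_single (f i)]
    rfl
  rw [Finset.sum_congr rfl fun i _ => row i]
  exact Finset.univ_sum_single (M := fun i : Q => ∀ j : Q, Quiver.Path i j →₀ k) f

@[elab_as_elim]
theorem induction_path {motive : PathAlgebra k Q → Prop} (f : PathAlgebra k Q)
    (zero : motive 0) (add : ∀ f g, motive f → motive g → motive (f + g))
    (smul : ∀ (c : k) f, motive f → motive (c • f))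
    (path : ∀ {i j : Q} (p : Quiver.Path i j), motive (ofPath k p)) : motive f := by
  rw [← sum_ofHom f]
  refine Finset.sum_induction _ motive add zero fun i _ =>
    Finset.sum_induction _ motive add zero fun j _ => ?_
  induction f i j using Finsupp.induction_linear with
  | zero => simpa only [map_zero] using zero
  | add f g hf hg => simpa only [map_add] using add _ _ hf hg
  | single p c =>
    rw [← Finsupp.smul_single_one, map_smul]
    exact smul c _ (path p)

@[elab_as_elim]
theorem induction_generators {motive : PathAlgebra k Q → Prop} (f : PathAlgebra k Q)
    (zero : motive 0) (add : ∀ f g, motive f → motive g → motive (f + g))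
    (smul : ∀ (c : k) f, motive f → motive (c • f))
    (mul : ∀ f g, motive f → motive g → motive (f * g))
    (idem : ∀ i, motive (idem k i))
    (arrow : ∀ {i j : Q} (a : i ⟶ j), motive (ofPath k a.toPath)) : motive f := by
  refine induction_path f zero add smul fun p => ?_
  induction p with
  | nil => exact idem _
  | cons p a ih => exact ofPath_mul_ofPath (k := k) p a.toPath ▸ mul _ _ ih (arrow a)

section Lift

variable {A : Type*} [Ring A] [Algebra k A] {e : Q → A} {a : ∀ {i j : Q}, (i ⟶ j) → A}

variable (k e a) in
/-- The linear extension of `evalPath`. -/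
noncomputable def evalLinear : PathAlgebra k Q →ₗ[k] A :=
  LinearMap.lsum k (fun i : Q => ∀ j : Q, Quiver.Path i j →₀ k) k fun i =>
    LinearMap.lsum k (fun j : Q => Quiver.Path i j →₀ k) k fun _ =>
      Finsupp.linearCombination k (evalPath e a)

theorem evalLinear_ofPath {i j : Q} (p : Quiver.Path i j) :
    evalLinear k e a (ofPath k p) = evalPath e a p := by
  refine (LinearMap.lsum_piSingle (R := k) (φ := fun i : Q => ∀ j : Q, Quiver.Path i j →₀ k)
    k _ i _).trans ?_
  rw [LinearMap.lsum_piSingle, Finsupp.linearCombination_single, one_smul]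

theorem evalLinear_mul (he : OrthogonalIdempotents e)
    (har : ∀ {i j : Q} (f : i ⟶ j), a f * e j = a f) (f g : PathAlgebra k Q) :
    evalLinear k e a (f * g) = evalLinear k e a f * evalLinear k e a g := by
  induction f using induction_path with
  | zero => simp
  | add f₁ f₂ h₁ h₂ => simp [add_mul, h₁, h₂]
  | smul c f h => simp [h]
  | @path i l p =>
    induction g using induction_path with
    | zero => simp
    | add g₁ g₂ h₁ h₂ => simp [mul_add, h₁, h₂]
    | smul c g h => simp [h]
    | @path l' j q =>
      obtain rfl | h := eq_or_ne l l'
      · simp only [ofPath_mul_ofPath, evalLinear_ofPath, evalPath_comp he har]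
      · rw [ofPath_mul_ofPath_of_ne p q h, map_zero, evalLinear_ofPath, evalLinear_ofPath,
          evalPath_mul_evalPath_of_ne he har p q h]

/-- The universal property of the path algebra. -/
noncomputable def lift (he : CompleteOrthogonalIdempotents e)
    (har : ∀ {i j : Q} (f : i ⟶ j), a f * e j = a f) : PathAlgebra k Q →ₐ[k] A :=
  AlgHom.ofLinearMap (evalLinear k e a)
    (by
      rw [← completeOrthogonalIdempotents_idem.complete, map_sum, ← he.complete]
      exact Finset.sum_congr rfl fun i _ => evalLinear_ofPath _)
    (evalLinear_mul he.toOrthogonalIdempotents har)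

theorem lift_idem (he : CompleteOrthogonalIdempotents e)
    (har : ∀ {i j : Q} (f : i ⟶ j), a f * e j = a f) (i : Q) :
    lift he har (idem k i) = e i :=
  evalLinear_ofPath _

theorem lift_arrow (he : CompleteOrthogonalIdempotents e)
    (har : ∀ {i j : Q} (f : i ⟶ j), a f * e j = a f) {i j : Q} (f : i ⟶ j) :
    lift he har (ofPath k f.toPath) = e i * a f :=
  evalLinear_ofPath _

end Lift

end PathAlgebra

namespace BrauerConfiguration

open PathAlgebra

section Occurrence

variable {V P : Type*} [Fintype V] [Fintype P] {Γ : BrauerConfiguration V P}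

theorem card_vertexOccurrence (v : V) : Fintype.card (VertexOccurrence Γ.freq v) = Γ.val v := by
  simp [val]

theorem isCycleOn_next (v : V) :
    (Γ.next v).IsCycleOn ((Finset.univ : Finset (VertexOccurrence Γ.freq v)) : Set _) := by
  rw [Finset.coe_univ]
  exact ⟨Set.bijOn_univ.2 (Γ.next v).bijective, fun x _ y _ => Γ.next_cyclic v x y⟩

theorem succ_iterate (x : Γ.Occurrence) (n : ℕ) :
    Γ.succ^[n] x = ⟨x.1, (Γ.next x.1 ^ n) x.2⟩ := by
  induction n with
  | zero => rfl
  | succ n ih =>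
    rw [Function.iterate_succ_apply', ih, pow_succ', Equiv.Perm.mul_apply]
    rfl

theorem succ_iterate_eq_self_iff {x : Γ.Occurrence} {n : ℕ} :
    Γ.succ^[n] x = x ↔ Γ.val x.1 ∣ n := by
  obtain ⟨v, x⟩ := x
  rw [succ_iterate, ← card_vertexOccurrence, ← Finset.card_univ,
    ← (Γ.isCycleOn_next v).pow_apply_eq (Finset.mem_univ x)]
  simp

theorem exists_succ_iterate_eq {x y : Γ.Occurrence} (h : x.1 = y.1) : ∃ n, Γ.succ^[n] x = y := by
  obtain ⟨v, x⟩ := x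
  obtain ⟨w, y⟩ := y
  obtain rfl : v = w := h
  obtain ⟨n, -, hn⟩ :=
    (Γ.isCycleOn_next v).exists_pow_eq (Finset.mem_univ x) (Finset.mem_univ y)
  exact ⟨n, by rw [succ_iterate]; exact congrArg _ hn⟩

theorem succ_bijective : Function.Bijective Γ.succ :=
  (Equiv.sigmaCongrRight Γ.next).bijective

theorem val_pos (v : V) : 0 < Γ.val v :=
  Nat.pos_of_mul_pos_left (Nat.zero_lt_of_lt (Γ.nontruncated v))

variable (Γ)

/-- The length `μ(v) val(v)` of the power of a special cycle of `v` that occurs in the relations. -/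
def fullLength (v : V) : ℕ := Γ.mult v * Γ.val v

theorem one_lt_fullLength (v : V) : 1 < Γ.fullLength v := Γ.nontruncated v

theorem succ_iterate_fullLength (x : Γ.Occurrence) : Γ.succ^[Γ.fullLength x.1] x = x :=
  succ_iterate_eq_self_iff.2 (Dvd.intro_left _ rfl)

variable {Γ}

/-- The polygon of an occurrence, as a vertex of the Brauer quiver. -/
def node (x : Γ.Occurrence) : Γ.QuiverVertex := Γ.polygon x

theorem exists_fst_eq (v : V) : ∃ x : Γ.Occurrence, x.1 = v := by
  obtain ⟨i, hi⟩ := Γ.covers v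
  exact ⟨⟨v, i, ⟨0, hi⟩⟩, rfl⟩

theorem exists_node_eq (i : Γ.QuiverVertex) : ∃ x : Γ.Occurrence, node x = i := by
  obtain ⟨v, -, hv⟩ := Finset.exists_ne_zero_of_sum_ne_zero
    (Nat.ne_zero_of_lt (Γ.one_lt_size i))
  exact ⟨⟨v, i, ⟨0, Nat.pos_of_ne_zero hv⟩⟩, rfl⟩

variable (Γ) in
/-- Some occurrence of a given vertex. -/
noncomputable def vertexOcc (v : V) : Γ.Occurrence := (exists_fst_eq v).choose

theorem vertexOcc_fst (v : V) : (Γ.vertexOcc v).1 = v := (exists_fst_eq v).choose_spec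

/-- Some occurrence in a given polygon. -/
noncomputable def polygonOcc (i : Γ.QuiverVertex) : Γ.Occurrence := (exists_node_eq i).choose

theorem node_polygonOcc (i : Γ.QuiverVertex) : node (polygonOcc i) = i :=
  (exists_node_eq i).choose_spec

theorem eq_of_forall_succ {α : Type*} {c : Γ.Occurrence → α} (h : ∀ x, c (Γ.succ x) = c x)
    {x y : Γ.Occurrence} (hxy : x.1 = y.1) : c x = c y := by
  obtain ⟨n, rfl⟩ := exists_succ_iterate_eq hxy
  have hc : Function.Semiconj c Γ.succ id := h
  rw [(hc.iterate_right n).eq, Function.iterate_id, id]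

theorem Connected.eq_of_forall_node_succ {α : Type*} (hconn : Γ.Connected)
    {c : Γ.QuiverVertex → α} (h : ∀ x, c (node (Γ.succ x)) = c (node x))
    (i j : Γ.QuiverVertex) : c i = c j := by
  have of_shared {i j : P} {v : V} (hi : 0 < Γ.freq i v) (hj : 0 < Γ.freq j v) : c i = c j :=
    eq_of_forall_succ (c := c ∘ node) h (x := ⟨v, i, 0, hi⟩) (y := ⟨v, j, 0, hj⟩) rfl
  obtain ⟨w⟩ := hconn.preconnected i j
  induction w with
  | nil => rfl
  | cons hadj _ ih =>
    refine Eq.trans ?_ ih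
    obtain ⟨-, ⟨v, hi, hj⟩ | ⟨v, hj, hi⟩⟩ := (SimpleGraph.fromRel_adj _ _ _).1 hadj
    · exact of_shared hi hj
    · exact of_shared hi hj

end Occurrence

section Walk

variable {V P : Type*} [Fintype V] [Fintype P] {Γ : BrauerConfiguration V P} [DecidableEq P]
  (k : Type*) [Field k]

theorem arrow_eq_ofPath {i j : Γ.QuiverVertex} (a : i ⟶ j) :
    Γ.arrow k a.1 = ofPath k a.toPath := by
  obtain ⟨x, rfl, rfl⟩ := a
  rfl

theorem idem_mul_arrow (x : Γ.Occurrence) (i : Γ.QuiverVertex) :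
    idem k i * Γ.arrow k x = if node x = i then Γ.arrow k x else 0 := by
  split_ifs with h
  · subst h
    exact ofPath_mul_ofPath _ _
  · exact ofPath_mul_ofPath_of_ne _ _ (Ne.symm h)

theorem arrow_mul_idem (x : Γ.Occurrence) (i : Γ.QuiverVertex) :
    Γ.arrow k x * idem k i = if node (Γ.succ x) = i then Γ.arrow k x else 0 := by
  split_ifs with h
  · subst h
    exact ofPath_mul_ofPath _ _
  · exact ofPath_mul_ofPath_of_ne _ _ h

theorem arrow_mul_arrow_of_ne {x y : Γ.Occurrence} (h : node (Γ.succ x) ≠ node y) :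
    Γ.arrow k x * Γ.arrow k y = 0 :=
  ofPath_mul_ofPath_of_ne _ _ h

/-- The product of `n` consecutive arrows, starting from a given occurrence. -/
noncomputable def walk (x : Γ.Occurrence) (n : ℕ) : PathAlgebra k Γ.QuiverVertex :=
  ((List.range n).map fun t => Γ.arrow k (Γ.succ^[t] x)).prod

theorem walk_one (x : Γ.Occurrence) : walk k x 1 = Γ.arrow k x := by
  simp [walk]

theorem walk_add (x : Γ.Occurrence) (n m : ℕ) :
    walk k x (n + m) = walk k x n * walk k (Γ.succ^[n] x) m := by
  simp only [walk, List.range_add, List.map_append, List.map_map, List.prod_append,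
    Function.comp_def, ← Function.iterate_add_apply, add_comm]

theorem walk_succ (x : Γ.Occurrence) (n : ℕ) :
    walk k x (n + 1) = walk k x n * Γ.arrow k (Γ.succ^[n] x) := by
  rw [walk_add, walk_one]

theorem walk_succ' (x : Γ.Occurrence) (n : ℕ) :
    walk k x (n + 1) = Γ.arrow k x * walk k (Γ.succ x) n := by
  rw [add_comm, walk_add, walk_one]
  rfl

theorem specialCycle_pow (x : Γ.Occurrence) (n : ℕ) :
    Γ.specialCycle k x ^ n = walk k x (n * Γ.val x.1) := by
  induction n with
  | zero => simp [walk]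
  | succ n ih =>
    rw [pow_succ, ih, add_mul, one_mul, walk_add, succ_iterate_eq_self_iff.2 (Dvd.intro_left _ rfl)]
    rfl

end Walk

section NormalForm

variable {V P : Type*} [Fintype V] [Fintype P]

/-- The indices of a basis of the Brauer configuration algebra: the trivial paths, the nonempty
walks shorter than a full power of a special cycle, and for each polygon the common value of the
full powers of the special cycles starting there. -/
inductive NormalForm (Γ : BrauerConfiguration V P)
  | trivial (i : Γ.QuiverVertex)
  | run (x : Γ.Occurrence) (n : ℕ) (pos : 0 < n) (lt : n < Γ.fullLength x.1)
  | socle (i : Γ.QuiverVertex)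

variable {Γ : BrauerConfiguration V P} (k : Type*) [Field k]

/-- The coordinates of the walk of length `n > 0` starting at `x`. -/
noncomputable def walkVec (x : Γ.Occurrence) (n : ℕ) : NormalForm Γ →₀ k :=
  if h : 0 < n ∧ n < Γ.fullLength x.1 then .single (.run x n h.1 h.2) 1
  else if n = Γ.fullLength x.1 then .single (.socle (node x)) 1
  else 0

theorem walkVec_of_lt {x : Γ.Occurrence} {n : ℕ} (pos : 0 < n) (lt : n < Γ.fullLength x.1) :
    walkVec k x n = .single (.run x n pos lt) 1 :=
  dif_pos ⟨pos, lt⟩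

theorem walkVec_fullLength (x : Γ.Occurrence) :
    walkVec k x (Γ.fullLength x.1) = .single (.socle (node x)) 1 := by
  rw [walkVec, dif_neg fun h => h.2.false, if_pos rfl]

theorem walkVec_of_fullLength_lt {x : Γ.Occurrence} {n : ℕ} (h : Γ.fullLength x.1 < n) :
    walkVec k x n = 0 := by
  rw [walkVec, dif_neg fun h' => h.not_gt h'.2, if_neg h.ne']

theorem walkVec_apply_trivial (x : Γ.Occurrence) (n : ℕ) (i : Γ.QuiverVertex) :
    walkVec k x n (.trivial i) = 0 := by
  unfold walkVec
  split_ifs <;> simp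

theorem walkVec_apply_run [DecidableEq V] [DecidableEq P] (x y : Γ.Occurrence) (n m : ℕ)
    (pos : 0 < m) (lt : m < Γ.fullLength y.1) :
    walkVec k x n (.run y m pos lt) = if x = y ∧ n = m then 1 else 0 := by
  classical
  unfold walkVec
  split_ifs <;> simp only [Finsupp.single_apply, Finsupp.coe_zero, Pi.zero_apply] <;> grind

theorem walkVec_apply_socle [DecidableEq P] (x : Γ.Occurrence) (n : ℕ) (i : Γ.QuiverVertex) :
    walkVec k x n (.socle i) = if node x = i ∧ n = Γ.fullLength x.1 then 1 else 0 := by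
  classical
  unfold walkVec
  split_ifs <;> simp only [Finsupp.single_apply, Finsupp.coe_zero, Pi.zero_apply] <;> grind

variable {k} in
theorem linearMap_ext {M : Type*} [AddCommMonoid M] [Module k M]
    {φ ψ : (NormalForm Γ →₀ k) →ₗ[k] M}
    (trivial : ∀ i, φ (.single (.trivial i) 1) = ψ (.single (.trivial i) 1))
    (walk : ∀ x n, 0 < n → φ (walkVec k x n) = ψ (walkVec k x n)) : φ = ψ := by
  refine Finsupp.lhom_ext' fun b => LinearMap.ext_ring ?_
  simp only [LinearMap.comp_apply, Finsupp.lsingle_apply]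
  cases b with
  | trivial i => exact trivial i
  | run x n pos lt => simpa only [walkVec_of_lt k pos lt] using walk x n pos
  | socle i =>
    have := walk (polygonOcc i) (Γ.fullLength (polygonOcc i).1)
      (Nat.zero_lt_of_lt (Γ.one_lt_fullLength _))
    rwa [walkVec_fullLength, node_polygonOcc] at this

variable [DecidableEq P]

/-- The polygon in which the paths with a given normal form start. -/
def NormalForm.source : NormalForm Γ → Γ.QuiverVertex
  | .trivial i => i
  | .run x _ _ _ => node x
  | .socle i => i

/-- Left multiplication by the trivial path at `i` in coordinates. -/
noncomputable def idemAction (i : Γ.QuiverVertex) : Module.End k (NormalForm Γ →₀ k) :=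
  Finsupp.linearCombination k fun b => if b.source = i then .single b 1 else 0

theorem idemAction_single (i : Γ.QuiverVertex) (b : NormalForm Γ) :
    idemAction k i (.single b 1) = if b.source = i then .single b 1 else 0 := by
  rw [idemAction, Finsupp.linearCombination_single, one_smul]

theorem idemAction_trivial (i j : Γ.QuiverVertex) :
    idemAction k i (.single (.trivial j) 1) = if j = i then .single (.trivial j) 1 else 0 :=
  idemAction_single k i _

theorem idemAction_walkVec (i : Γ.QuiverVertex) (x : Γ.Occurrence) (n : ℕ) :
    idemAction k i (walkVec k x n) = if node x = i then walkVec k x n else 0 := by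
  unfold walkVec
  split_ifs <;> simp_all [idemAction_single, NormalForm.source]

theorem completeOrthogonalIdempotents_idemAction :
    CompleteOrthogonalIdempotents (idemAction (Γ := Γ) k) where
  idem i := Finsupp.lhom_ext' fun b => LinearMap.ext_ring <| by
    by_cases h : b.source = i <;> simp [idemAction_single, h]
  ortho i j hij := Finsupp.lhom_ext' fun b => LinearMap.ext_ring <| by
    by_cases h : b.source = j <;> simp [idemAction_single, h, hij.symm]
  complete := Finsupp.lhom_ext' fun b => LinearMap.ext_ring <| by
    simp [idemAction_single]

variable [DecidableEq V]

/-- Left multiplication by the arrow starting at `y` in coordinates. -/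
noncomputable def arrowAction (y : Γ.Occurrence) : Module.End k (NormalForm Γ →₀ k) :=
  Finsupp.linearCombination k fun
    | .trivial i => if node (Γ.succ y) = i then walkVec k y 1 else 0
    | .run x n _ _ => if x = Γ.succ y then walkVec k y (n + 1) else 0
    | .socle _ => 0

theorem arrowAction_trivial (y : Γ.Occurrence) (i : Γ.QuiverVertex) :
    arrowAction k y (.single (.trivial i) 1)
      = if node (Γ.succ y) = i then walkVec k y 1 else 0 := by
  rw [arrowAction, Finsupp.linearCombination_single, one_smul]

theorem arrowAction_walkVec (y x : Γ.Occurrence) {n : ℕ} (hn : 0 < n) :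
    arrowAction k y (walkVec k x n) = if x = Γ.succ y then walkVec k y (n + 1) else 0 := by
  have overflow (h : Γ.fullLength x.1 ≤ n) :
      (if x = Γ.succ y then walkVec k y (n + 1) else 0) = 0 := by
    split_ifs with hx
    · subst hx
      exact walkVec_of_fullLength_lt k (Nat.lt_succ_of_le h)
    · rfl
  obtain h | rfl | h := lt_trichotomy n (Γ.fullLength x.1)
  · rw [walkVec_of_lt k hn h, arrowAction, Finsupp.linearCombination_single, one_smul]
  · rw [overflow le_rfl, walkVec_fullLength, arrowAction, Finsupp.linearCombination_single,
      one_smul]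
  · rw [overflow h.le, walkVec_of_fullLength_lt k h, map_zero]

theorem idemAction_mul_arrowAction (y : Γ.Occurrence) :
    idemAction k (node y) * arrowAction k y = arrowAction k y := by
  refine linearMap_ext (fun i => ?_) fun x n hn => ?_
  · rw [Module.End.mul_apply, arrowAction_trivial, apply_ite (idemAction k (node y)),
      idemAction_walkVec, if_pos rfl, map_zero]
  · rw [Module.End.mul_apply, arrowAction_walkVec k y x hn, apply_ite (idemAction k (node y)),
      idemAction_walkVec, if_pos rfl, map_zero]

theorem arrowAction_mul_idemAction (y : Γ.Occurrence) :
    arrowAction k y * idemAction k (node (Γ.succ y)) = arrowAction k y := by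
  refine linearMap_ext (fun i => ?_) fun x n hn => ?_
  · rw [Module.End.mul_apply, idemAction_trivial]
    split_ifs with h
    · rfl
    · rw [map_zero, arrowAction_trivial, if_neg (Ne.symm h)]
  · rw [Module.End.mul_apply, idemAction_walkVec]
    split_ifs with h
    · rfl
    · rw [map_zero, arrowAction_walkVec k y x hn, if_neg fun hx => h (congrArg node hx)]

/-- Left multiplication by an arrow of the Brauer quiver in coordinates. -/
noncomputable def homAction {i j : Γ.QuiverVertex} (f : i ⟶ j) :
    Module.End k (NormalForm Γ →₀ k) :=
  arrowAction k f.1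

theorem homAction_mul_idemAction {i j : Γ.QuiverVertex} (f : i ⟶ j) :
    homAction k f * idemAction k j = homAction k f := by
  obtain ⟨y, rfl, rfl⟩ := f
  exact arrowAction_mul_idemAction k y

/-- The left regular representation of the Brauer configuration algebra, in coordinates and
inflated to the path algebra. -/
noncomputable def action : PathAlgebra k Γ.QuiverVertex →ₐ[k] Module.End k (NormalForm Γ →₀ k) :=
  PathAlgebra.lift (a := homAction k) (completeOrthogonalIdempotents_idemAction k)
    (homAction_mul_idemAction k)

theorem action_idem (i : Γ.QuiverVertex) : action k (idem k i) = idemAction k i :=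
  PathAlgebra.lift_idem (a := homAction k) _ (homAction_mul_idemAction k) i

theorem action_arrow (y : Γ.Occurrence) : action k (Γ.arrow k y) = arrowAction k y :=
  (PathAlgebra.lift_arrow (a := homAction k) _ (homAction_mul_idemAction k) _).trans
    (idemAction_mul_arrowAction k y)

theorem action_walk_walkVec (x y : Γ.Occurrence) {n m : ℕ} (hn : 0 < n) (hm : 0 < m) :
    action k (walk k x n) (walkVec k y m)
      = if y = Γ.succ^[n] x then walkVec k x (n + m) else 0 := by
  induction n, hn using Nat.le_induction generalizing x with
  | base => rw [walk_one, action_arrow, arrowAction_walkVec k x y hm, add_comm]; rfl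
  | succ n hn ih =>
    rw [walk_succ', map_mul, Module.End.mul_apply, ih, action_arrow, ← Function.iterate_succ_apply,
      apply_ite (arrowAction k x), arrowAction_walkVec k _ _ (Nat.add_pos_left hn m), if_pos rfl,
      map_zero, Nat.succ_eq_add_one, add_right_comm]

theorem action_walk_trivial (x : Γ.Occurrence) (i : Γ.QuiverVertex) {n : ℕ} (hn : 0 < n) :
    action k (walk k x n) (.single (.trivial i) 1)
      = if node (Γ.succ^[n] x) = i then walkVec k x n else 0 := by
  induction n, hn using Nat.le_induction generalizing x with
  | base => rw [walk_one, action_arrow, arrowAction_trivial]; rfl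
  | succ n hn ih =>
    rw [walk_succ', map_mul, Module.End.mul_apply, ih, action_arrow, ← Function.iterate_succ_apply,
      apply_ite (arrowAction k x), arrowAction_walkVec k _ _ hn, if_pos rfl, map_zero]

end NormalForm

section Algebra

variable {V P : Type*} [Fintype V] [Fintype P] {Γ : BrauerConfiguration V P} [DecidableEq P]
  (k : Type*) [Field k]

/-- The quotient map from the path algebra onto the Brauer configuration algebra. -/
noncomputable def proj : PathAlgebra k Γ.QuiverVertex →ₐ[k] Γ.BrauerAlgebra k :=
  RingCon.mkₐ k _

theorem proj_surjective : Function.Surjective (proj k (Γ := Γ)) :=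
  RingCon.mkₐ_surjective (α := k) _

variable {k} in
theorem proj_eq_zero {r : PathAlgebra k Γ.QuiverVertex} (h : Γ.IsRelation k r) :
    proj k r = 0 :=
  (RingCon.eq _).2 ((TwoSidedIdeal.mem_iff _ _).1 (TwoSidedIdeal.subset_span h))

/-- The class of the trivial path at a polygon. -/
noncomputable def idemClass (i : Γ.QuiverVertex) : Γ.BrauerAlgebra k := proj k (idem k i)

/-- The class of a product of consecutive arrows; the arrows themselves are the case of length
`1`. -/
noncomputable def walkClass (x : Γ.Occurrence) (n : ℕ) : Γ.BrauerAlgebra k :=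
  proj k (walk k x n)

theorem completeOrthogonalIdempotents_idemClass :
    CompleteOrthogonalIdempotents (idemClass k (Γ := Γ)) :=
  completeOrthogonalIdempotents_idem.map (proj k).toRingHom

theorem idemClass_mul_idemClass (i j : Γ.QuiverVertex) :
    idemClass k i * idemClass k j = if i = j then idemClass k i else 0 :=
  (completeOrthogonalIdempotents_idemClass k).mul_eq i j

theorem idemClass_mul_walkClass (i : Γ.QuiverVertex) (x : Γ.Occurrence) {n : ℕ} (hn : 0 < n) :
    idemClass k i * walkClass k x n = if node x = i then walkClass k x n else 0 := by
  obtain ⟨n, rfl⟩ := Nat.exists_eq_add_of_le' hn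
  rw [idemClass, walkClass, ← map_mul, walk_succ', ← mul_assoc, idem_mul_arrow]
  split_ifs <;> simp only [zero_mul, map_zero]

theorem walkClass_mul_idemClass (x : Γ.Occurrence) {n : ℕ} (hn : 0 < n) (i : Γ.QuiverVertex) :
    walkClass k x n * idemClass k i
      = if node (Γ.succ^[n] x) = i then walkClass k x n else 0 := by
  obtain ⟨n, rfl⟩ := Nat.exists_eq_add_of_le' hn
  rw [idemClass, walkClass, ← map_mul, walk_succ, mul_assoc, arrow_mul_idem,
    Function.iterate_succ_apply']
  split_ifs <;> simp only [mul_zero, map_zero]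

theorem proj_arrow_mul_arrow_of_ne {x y : Γ.Occurrence} (h : y ≠ Γ.succ x) :
    proj k (Γ.arrow k x * Γ.arrow k y) = 0 := by
  by_cases hn : node (Γ.succ x) = node y
  · exact proj_eq_zero (.arrow_mul_arrow x y hn h)
  · rw [arrow_mul_arrow_of_ne k hn, map_zero]

theorem walkClass_fullLength_eq {x y : Γ.Occurrence} (h : node x = node y) :
    walkClass k x (Γ.fullLength x.1) = walkClass k y (Γ.fullLength y.1) := by
  rw [← sub_eq_zero, walkClass, walkClass, ← map_sub, fullLength, fullLength, ← specialCycle_pow,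
    ← specialCycle_pow]
  exact proj_eq_zero (.cycle_sub_cycle x y h)

theorem walkClass_of_fullLength_lt {x : Γ.Occurrence} {n : ℕ} (h : Γ.fullLength x.1 < n) :
    walkClass k x n = 0 := by
  obtain ⟨r, rfl⟩ := Nat.exists_eq_add_of_le h
  rw [walkClass, walk_add, walk_succ, succ_iterate_fullLength, fullLength, ← specialCycle_pow,
    map_mul, proj_eq_zero (.cycle_mul_arrow x), zero_mul]

variable [DecidableEq V]

theorem walkClass_one_mul_walkClass (y x : Γ.Occurrence) {n : ℕ} (hn : 0 < n) :
    walkClass k y 1 * walkClass k x n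
      = if x = Γ.succ y then walkClass k y (n + 1) else 0 := by
  obtain ⟨n, rfl⟩ := Nat.exists_eq_add_of_le' hn
  split_ifs with h
  · rw [h, walkClass, walkClass, ← map_mul, walk_one, ← walk_succ']
    rfl
  · rw [walkClass, walkClass, ← map_mul, walk_one, walk_succ', ← mul_assoc, map_mul,
      proj_arrow_mul_arrow_of_ne k h, zero_mul]

theorem walkClass_mul_walkClass_one (x y : Γ.Occurrence) {n : ℕ} (hn : 0 < n) :
    walkClass k x n * walkClass k y 1
      = if y = Γ.succ^[n] x then walkClass k x (n + 1) else 0 := by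
  obtain ⟨n, rfl⟩ := Nat.exists_eq_add_of_le' hn
  rw [walkClass, walkClass, ← map_mul, walk_one]
  split_ifs with h
  · rw [h, ← walk_succ]
    rfl
  · rw [walk_succ, mul_assoc, map_mul, proj_arrow_mul_arrow_of_ne k, mul_zero]
    rwa [← Function.iterate_succ_apply' Γ.succ]

theorem action_walk_of_fullLength_lt {x : Γ.Occurrence} {n : ℕ} (h : Γ.fullLength x.1 < n) :
    action k (walk k x n) = 0 := by
  have hn := Nat.zero_lt_of_lt h
  refine linearMap_ext (fun i => ?_) fun y m hm => ?_
  · rw [action_walk_trivial k x i hn, walkVec_of_fullLength_lt k h, ite_self,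
      LinearMap.zero_apply]
  · rw [action_walk_walkVec k x y hn hm, walkVec_of_fullLength_lt k (h.trans_le le_self_add),
      ite_self, LinearMap.zero_apply]

theorem action_walk_fullLength_eq {x y : Γ.Occurrence} (h : node x = node y) :
    action k (walk k x (Γ.fullLength x.1)) = action k (walk k y (Γ.fullLength y.1)) := by
  have pos (x : Γ.Occurrence) : 0 < Γ.fullLength x.1 := Nat.zero_lt_of_lt (Γ.one_lt_fullLength _)
  refine linearMap_ext (fun i => ?_) fun z m hm => ?_
  · simp only [action_walk_trivial k _ i (pos _), succ_iterate_fullLength, walkVec_fullLength, h]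
  · simp only [action_walk_walkVec k _ z (pos _) hm,
      walkVec_of_fullLength_lt k (Nat.lt_add_of_pos_right hm), ite_self]

theorem arrowAction_mul_arrowAction_of_ne {x y : Γ.Occurrence} (h : y ≠ Γ.succ x) :
    arrowAction k x * arrowAction k y = 0 := by
  refine linearMap_ext (fun i => ?_) fun z m hm => ?_
  · rw [Module.End.mul_apply, arrowAction_trivial, apply_ite (arrowAction k x),
      arrowAction_walkVec k x y one_pos, if_neg h, map_zero, ite_self, LinearMap.zero_apply]
  · rw [Module.End.mul_apply, arrowAction_walkVec k y z hm, apply_ite (arrowAction k x),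
      arrowAction_walkVec k x y m.succ_pos, if_neg h, map_zero, ite_self, LinearMap.zero_apply]

theorem action_eq_zero_of_isRelation {r : PathAlgebra k Γ.QuiverVertex} (h : Γ.IsRelation k r) :
    action k r = 0 := by
  cases h with
  | cycle_sub_cycle x y h =>
    rw [specialCycle_pow, specialCycle_pow, map_sub, sub_eq_zero]
    exact action_walk_fullLength_eq k h
  | cycle_mul_arrow x =>
    have : Γ.specialCycle k x ^ Γ.mult x.1 * Γ.arrow k x
        = walk k x (Γ.fullLength x.1 + 1) := by
      rw [walk_succ, succ_iterate_fullLength, specialCycle_pow, fullLength]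
    rw [this, action_walk_of_fullLength_lt k (Nat.lt_succ_self _)]
  | arrow_mul_arrow x y _ hne =>
    rw [map_mul, action_arrow, action_arrow, arrowAction_mul_arrowAction_of_ne k hne]

/-- The left regular representation of the Brauer configuration algebra, in coordinates. -/
noncomputable def regularRep :
    Γ.BrauerAlgebra k →ₐ[k] Module.End k (NormalForm Γ →₀ k) :=
  RingCon.liftₐ _ (action k) <| by
    have le : TwoSidedIdeal.span {r | Γ.IsRelation k r} ≤ TwoSidedIdeal.ker (action k) :=
      TwoSidedIdeal.span_le.2 fun r hr =>
        (TwoSidedIdeal.mem_ker _).2 (action_eq_zero_of_isRelation k hr)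
    exact TwoSidedIdeal.ringCon_le_iff.1 le

end Algebra

section Basis

variable {V P : Type*} [Fintype V] [Fintype P] {Γ : BrauerConfiguration V P} [DecidableEq P]
  (k : Type*) [Field k]

/-- The element of the Brauer configuration algebra with a given normal form. -/
noncomputable def NormalForm.toAlgebra : NormalForm Γ → Γ.BrauerAlgebra k
  | .trivial i => idemClass k i
  | .run x n _ _ => walkClass k x n
  | .socle i => walkClass k (polygonOcc i) (Γ.fullLength (polygonOcc i).1)

/-- The linear combination of normal forms with given coordinates. -/
noncomputable def realize : (NormalForm Γ →₀ k) →ₗ[k] Γ.BrauerAlgebra k :=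
  Finsupp.linearCombination k (NormalForm.toAlgebra k)

theorem realize_single (b : NormalForm Γ) : realize k (.single b 1) = b.toAlgebra k := by
  rw [realize, Finsupp.linearCombination_single, one_smul]

theorem realize_walkVec (x : Γ.Occurrence) {n : ℕ} (hn : 0 < n) :
    realize k (walkVec k x n) = walkClass k x n := by
  obtain h | rfl | h := lt_trichotomy n (Γ.fullLength x.1)
  · rw [walkVec_of_lt k hn h, realize_single, NormalForm.toAlgebra]
  · rw [walkVec_fullLength, realize_single, NormalForm.toAlgebra,
      walkClass_fullLength_eq k (node_polygonOcc _)]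
  · rw [walkVec_of_fullLength_lt k h, walkClass_of_fullLength_lt k h, map_zero]

theorem realize_idemAction (i : Γ.QuiverVertex) (m : NormalForm Γ →₀ k) :
    realize k (idemAction k i m) = idemClass k i * realize k m := by
  suffices h : realize k ∘ₗ idemAction k i = .mulLeft k (idemClass k i) ∘ₗ realize k from
    LinearMap.congr_fun h m
  refine linearMap_ext (fun j => ?_) fun x n hn => ?_
  · simp only [LinearMap.comp_apply, LinearMap.mulLeft_apply, idemAction_trivial, realize_single,
      apply_ite (realize k), map_zero, NormalForm.toAlgebra]
    rw [idemClass_mul_idemClass]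
    grind
  · simp only [LinearMap.comp_apply, LinearMap.mulLeft_apply, idemAction_walkVec,
      apply_ite (realize k), map_zero, realize_walkVec k x hn, idemClass_mul_walkClass k i x hn]

variable [DecidableEq V]

theorem realize_arrowAction (y : Γ.Occurrence) (m : NormalForm Γ →₀ k) :
    realize k (arrowAction k y m) = walkClass k y 1 * realize k m := by
  suffices h : realize k ∘ₗ arrowAction k y = .mulLeft k (walkClass k y 1) ∘ₗ realize k from
    LinearMap.congr_fun h m
  refine linearMap_ext (fun j => ?_) fun x n hn => ?_
  · simp only [LinearMap.comp_apply, LinearMap.mulLeft_apply, arrowAction_trivial, realize_single,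
      apply_ite (realize k), map_zero, NormalForm.toAlgebra, realize_walkVec k y one_pos,
      walkClass_mul_idemClass k y one_pos, Function.iterate_one]
  · simp only [LinearMap.comp_apply, LinearMap.mulLeft_apply, arrowAction_walkVec k y x hn,
      apply_ite (realize k), map_zero, realize_walkVec k x hn, realize_walkVec k y n.succ_pos,
      walkClass_one_mul_walkClass k y x hn]

theorem realize_action (f : PathAlgebra k Γ.QuiverVertex) (m : NormalForm Γ →₀ k) :
    realize k (action k f m) = proj k f * realize k m := by
  induction f using induction_generators generalizing m with
  | zero => simp only [map_zero, LinearMap.zero_apply, zero_mul]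
  | add f g hf hg => simp only [map_add, LinearMap.add_apply, add_mul, hf, hg]
  | smul c f hf => simp only [map_smul, LinearMap.smul_apply, smul_mul_assoc, hf]
  | mul f g hf hg => rw [map_mul, map_mul, Module.End.mul_apply, hf, hg, mul_assoc]
  | idem i => rw [action_idem, realize_idemAction, idemClass]
  | arrow a =>
    rw [← arrow_eq_ofPath, action_arrow, realize_arrowAction, walkClass, walk_one]

/-- The coordinates of an element of the Brauer configuration algebra, read off from its action on
the coordinate vector of `1`. -/
noncomputable def coordinates : Γ.BrauerAlgebra k →ₗ[k] NormalForm Γ →₀ k :=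
  LinearMap.applyₗ (∑ i, .single (.trivial i) 1) ∘ₗ (regularRep k).toLinearMap

theorem coordinates_proj (f : PathAlgebra k Γ.QuiverVertex) :
    coordinates k (proj k f) = ∑ i, action k f (.single (.trivial i) 1) :=
  map_sum (action k f) _ _

theorem coordinates_idemClass (i : Γ.QuiverVertex) :
    coordinates k (idemClass k i) = .single (.trivial i) 1 := by
  simp only [idemClass, coordinates_proj, action_idem, idemAction_trivial, Finset.sum_ite_eq',
    Finset.mem_univ, if_true]

theorem coordinates_walkClass (x : Γ.Occurrence) {n : ℕ} (hn : 0 < n) :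
    coordinates k (walkClass k x n) = walkVec k x n := by
  simp only [walkClass, coordinates_proj, action_walk_trivial k x _ hn, Finset.sum_ite_eq,
    Finset.mem_univ, if_true]

theorem realize_coordinates (z : Γ.BrauerAlgebra k) : realize k (coordinates k z) = z := by
  obtain ⟨f, rfl⟩ := proj_surjective k z
  have realize_one : realize k (∑ i, .single (.trivial (Γ := Γ) i) 1) = 1 := by
    simp only [map_sum, realize_single, NormalForm.toAlgebra,
      (completeOrthogonalIdempotents_idemClass k).complete]
  exact (realize_action k f _).trans (by rw [realize_one, mul_one])

theorem coordinates_injective : Function.Injective (coordinates k (Γ := Γ)) :=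
  Function.LeftInverse.injective (realize_coordinates k)

variable {k} in
omit [DecidableEq V] in
theorem algebra_linearMap_ext {M : Type*} [AddCommMonoid M] [Module k M]
    {φ ψ : Γ.BrauerAlgebra k →ₗ[k] M} (idem : ∀ i, φ (idemClass k i) = ψ (idemClass k i))
    (walk : ∀ x n, 0 < n → φ (walkClass k x n) = ψ (walkClass k x n)) : φ = ψ := by
  classical
  suffices h : φ ∘ₗ realize k = ψ ∘ₗ realize k by
    ext z
    rw [← realize_coordinates k z]
    exact LinearMap.congr_fun h _
  refine linearMap_ext (fun i => ?_) fun x n hn => ?_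
  · simpa only [LinearMap.comp_apply, realize_single, NormalForm.toAlgebra] using idem i
  · simpa only [LinearMap.comp_apply, realize_walkVec k x hn] using walk x n hn

end Basis

section Coordinates

variable {V P : Type*} [Fintype V] [Fintype P] {Γ : BrauerConfiguration V P} [DecidableEq P]
  [DecidableEq V] {k : Type*} [Field k]

variable (k) in
/-- The coefficient of a given normal form. -/
noncomputable def coord (b : NormalForm Γ) : Γ.BrauerAlgebra k →ₗ[k] k :=
  Finsupp.lapply b ∘ₗ coordinates k

theorem coord_idemClass_trivial (i j : Γ.QuiverVertex) :
    coord k (.trivial i) (idemClass k j) = if j = i then 1 else 0 := by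
  classical
  simp only [coord, LinearMap.comp_apply, coordinates_idemClass, Finsupp.lapply_apply,
    Finsupp.single_apply, NormalForm.trivial.injEq]

theorem coord_idemClass_run (x : Γ.Occurrence) (n : ℕ) (pos lt) (j : Γ.QuiverVertex) :
    coord k (.run x n pos lt) (idemClass k j) = 0 := by
  classical
  simp only [coord, LinearMap.comp_apply, coordinates_idemClass, Finsupp.lapply_apply,
    Finsupp.single_apply, reduceCtorEq, if_false]

theorem coord_idemClass_socle (i j : Γ.QuiverVertex) :
    coord k (.socle i) (idemClass k j) = 0 := by
  classical
  simp only [coord, LinearMap.comp_apply, coordinates_idemClass, Finsupp.lapply_apply,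
    Finsupp.single_apply, reduceCtorEq, if_false]

theorem coord_one_trivial (i : Γ.QuiverVertex) : coord k (.trivial i) 1 = 1 := by
  rw [← (completeOrthogonalIdempotents_idemClass k).complete, map_sum]
  simp only [coord_idemClass_trivial, Finset.sum_ite_eq', Finset.mem_univ, if_true]

theorem coord_one_run (x : Γ.Occurrence) (n : ℕ) (pos lt) :
    coord k (.run x n pos lt) 1 = 0 := by
  rw [← (completeOrthogonalIdempotents_idemClass k).complete, map_sum]
  simp only [coord_idemClass_run, Finset.sum_const_zero]

theorem coord_one_socle (i : Γ.QuiverVertex) : coord k (.socle i) 1 = 0 := by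
  rw [← (completeOrthogonalIdempotents_idemClass k).complete, map_sum]
  simp only [coord_idemClass_socle, Finset.sum_const_zero]

theorem coord_walkClass_trivial (i : Γ.QuiverVertex) (x : Γ.Occurrence) {n : ℕ} (hn : 0 < n) :
    coord k (.trivial i) (walkClass k x n) = 0 := by
  simp only [coord, LinearMap.comp_apply, coordinates_walkClass k x hn, Finsupp.lapply_apply,
    walkVec_apply_trivial]

theorem coord_walkClass_run (y : Γ.Occurrence) (m : ℕ) (pos lt) (x : Γ.Occurrence) {n : ℕ}
    (hn : 0 < n) :
    coord k (.run y m pos lt) (walkClass k x n) = if x = y ∧ n = m then 1 else 0 := by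
  simp only [coord, LinearMap.comp_apply, coordinates_walkClass k x hn, Finsupp.lapply_apply,
    walkVec_apply_run]

theorem coord_walkClass_socle (i : Γ.QuiverVertex) (x : Γ.Occurrence) {n : ℕ} (hn : 0 < n) :
    coord k (.socle i) (walkClass k x n)
      = if node x = i ∧ n = Γ.fullLength x.1 then 1 else 0 := by
  simp only [coord, LinearMap.comp_apply, coordinates_walkClass k x hn, Finsupp.lapply_apply,
    walkVec_apply_socle]

theorem coord_run_one_walkClass_one_mul (y : Γ.Occurrence) (z : Γ.BrauerAlgebra k) :
    coord k (.run y 1 one_pos (Γ.one_lt_fullLength y.1)) (walkClass k y 1 * z)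
      = coord k (.trivial (node (Γ.succ y))) z := by
  suffices h : coord k (.run y 1 one_pos (Γ.one_lt_fullLength y.1)) ∘ₗ .mulLeft k (walkClass k y 1)
      = coord k (.trivial (node (Γ.succ y))) from LinearMap.congr_fun h z
  refine algebra_linearMap_ext (fun i => ?_) fun x n hn => ?_
  · simp only [LinearMap.comp_apply, LinearMap.mulLeft_apply, walkClass_mul_idemClass k y one_pos,
      apply_ite (coord k _), map_zero, coord_walkClass_run _ _ _ _ y one_pos,
      coord_idemClass_trivial, Function.iterate_one, and_self, if_true, eq_comm]
  · simp only [LinearMap.comp_apply, LinearMap.mulLeft_apply, walkClass_one_mul_walkClass k y x hn,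
      apply_ite (coord k _), map_zero, coord_walkClass_run _ _ _ _ y n.succ_pos,
      coord_walkClass_trivial _ x hn]
    grind

theorem coord_run_one_mul_walkClass_one (y : Γ.Occurrence) (z : Γ.BrauerAlgebra k) :
    coord k (.run y 1 one_pos (Γ.one_lt_fullLength y.1)) (z * walkClass k y 1)
      = coord k (.trivial (node y)) z := by
  suffices h : coord k (.run y 1 one_pos (Γ.one_lt_fullLength y.1)) ∘ₗ .mulRight k (walkClass k y 1)
      = coord k (.trivial (node y)) from LinearMap.congr_fun h z
  refine algebra_linearMap_ext (fun i => ?_) fun x n hn => ?_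
  · simp only [LinearMap.comp_apply, LinearMap.mulRight_apply,
      idemClass_mul_walkClass k i y one_pos, apply_ite (coord k _), map_zero,
      coord_walkClass_run _ _ _ _ y one_pos, coord_idemClass_trivial, and_self, if_true, eq_comm]
  · simp only [LinearMap.comp_apply, LinearMap.mulRight_apply,
      walkClass_mul_walkClass_one k x y hn, apply_ite (coord k _), map_zero,
      coord_walkClass_run _ _ _ _ x n.succ_pos, coord_walkClass_trivial _ x hn]
    grind

theorem coord_run_succ_walkClass_one_mul (y : Γ.Occurrence) {n : ℕ} (pos : 0 < n)
    (lt : n + 1 < Γ.fullLength y.1) (z : Γ.BrauerAlgebra k) :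
    coord k (.run y (n + 1) n.succ_pos lt) (walkClass k y 1 * z)
      = coord k (.run (Γ.succ y) n pos (Nat.lt_of_succ_lt lt)) z := by
  suffices h : coord k (.run y (n + 1) n.succ_pos lt) ∘ₗ .mulLeft k (walkClass k y 1)
      = coord k (.run (Γ.succ y) n pos (Nat.lt_of_succ_lt lt)) from LinearMap.congr_fun h z
  refine algebra_linearMap_ext (fun i => ?_) fun x m hm => ?_
  · simp only [LinearMap.comp_apply, LinearMap.mulLeft_apply, walkClass_mul_idemClass k y one_pos,
      apply_ite (coord k _), map_zero, coord_walkClass_run _ _ _ _ y one_pos,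
      coord_idemClass_run]
    grind
  · simp only [LinearMap.comp_apply, LinearMap.mulLeft_apply, walkClass_one_mul_walkClass k y x hm,
      apply_ite (coord k _), map_zero, coord_walkClass_run _ _ _ _ y m.succ_pos,
      coord_walkClass_run _ _ _ _ x hm]
    grind

theorem coord_run_succ_mul_walkClass_one (y : Γ.Occurrence) {n : ℕ} (pos : 0 < n)
    (lt : n + 1 < Γ.fullLength y.1) (z : Γ.BrauerAlgebra k) :
    coord k (.run y (n + 1) n.succ_pos lt) (z * walkClass k y 1)
      = if Γ.val y.1 ∣ n then coord k (.run y n pos (Nat.lt_of_succ_lt lt)) z else 0 := by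
  suffices h : coord k (.run y (n + 1) n.succ_pos lt) ∘ₗ .mulRight k (walkClass k y 1)
      = (if Γ.val y.1 ∣ n then 1 else 0 : k) • coord k (.run y n pos (Nat.lt_of_succ_lt lt)) by
    refine (LinearMap.congr_fun h z).trans ?_
    rw [LinearMap.smul_apply, ite_smul, one_smul, zero_smul]
  refine algebra_linearMap_ext (fun i => ?_) fun x m hm => ?_
  · simp only [LinearMap.comp_apply, LinearMap.mulRight_apply, LinearMap.smul_apply,
      idemClass_mul_walkClass k i y one_pos, apply_ite (coord k _), map_zero,
      coord_walkClass_run _ _ _ _ y one_pos, coord_idemClass_run, smul_zero]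
    grind
  · simp only [LinearMap.comp_apply, LinearMap.mulRight_apply, LinearMap.smul_apply,
      walkClass_mul_walkClass_one k x y hm, apply_ite (coord k _), map_zero,
      coord_walkClass_run _ _ _ _ x m.succ_pos, coord_walkClass_run _ _ _ _ x hm,
      ← succ_iterate_eq_self_iff, smul_eq_mul]
    grind

theorem coord_run_idemClass_mul (x : Γ.Occurrence) (n : ℕ) (pos lt) (z : Γ.BrauerAlgebra k) :
    coord k (.run x n pos lt) (idemClass k (node x) * z) = coord k (.run x n pos lt) z := by
  suffices h : coord k (.run x n pos lt) ∘ₗ .mulLeft k (idemClass k (node x))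
      = coord k (.run x n pos lt) from LinearMap.congr_fun h z
  refine algebra_linearMap_ext (fun i => ?_) fun y m hm => ?_
  · simp only [LinearMap.comp_apply, LinearMap.mulLeft_apply, idemClass_mul_idemClass,
      apply_ite (coord k _), map_zero, coord_idemClass_run, ite_self]
  · simp only [LinearMap.comp_apply, LinearMap.mulLeft_apply, idemClass_mul_walkClass k _ y hm,
      apply_ite (coord k _), map_zero, coord_walkClass_run _ _ _ _ y hm]
    grind

theorem coord_run_mul_idemClass_of_ne {x : Γ.Occurrence} {n : ℕ} {i : Γ.QuiverVertex}
    (h : node (Γ.succ^[n] x) ≠ i) (pos lt) (z : Γ.BrauerAlgebra k) :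
    coord k (.run x n pos lt) (z * idemClass k i) = 0 := by
  suffices h : coord k (.run x n pos lt) ∘ₗ .mulRight k (idemClass k i) = 0 from
    LinearMap.congr_fun h z
  refine algebra_linearMap_ext (fun j => ?_) fun y m hm => ?_
  · simp only [LinearMap.comp_apply, LinearMap.mulRight_apply, idemClass_mul_idemClass,
      apply_ite (coord k _), map_zero, coord_idemClass_run, ite_self, LinearMap.zero_apply]
  · simp only [LinearMap.comp_apply, LinearMap.mulRight_apply, walkClass_mul_idemClass k y hm,
      apply_ite (coord k _), map_zero, coord_walkClass_run _ _ _ _ y hm, LinearMap.zero_apply]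
    grind

end Coordinates

section Center

variable {V P : Type*} [Fintype V] [Fintype P] {Γ : BrauerConfiguration V P} [DecidableEq P]
  {k : Type*} [Field k]

theorem mem_center_of_commute {z : Γ.BrauerAlgebra k} (idem : ∀ i, Commute z (idemClass k i))
    (arrow : ∀ x, Commute z (walkClass k x 1)) :
    z ∈ Subalgebra.center k (Γ.BrauerAlgebra k) := by
  rw [Subalgebra.mem_center_iff]
  intro b
  obtain ⟨f, rfl⟩ := proj_surjective k b
  suffices h : Commute z (proj k f) from h.eq.symm
  induction f using induction_generators with
  | zero => rw [map_zero]; exact Commute.zero_right _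
  | add f g hf hg => rw [map_add]; exact hf.add_right hg
  | smul c f hf => rw [map_smul]; exact hf.smul_right c
  | mul f g hf hg => rw [map_mul]; exact hf.mul_right hg
  | idem i => exact idem i
  | arrow a => rw [← arrow_eq_ofPath, ← walk_one]; exact arrow _

theorem commute_walkClass_idemClass {x : Γ.Occurrence} {n : ℕ} (hn : 0 < n)
    (closed : node (Γ.succ^[n] x) = node x) (i : Γ.QuiverVertex) :
    Commute (walkClass k x n) (idemClass k i) := by
  rw [commute_iff_eq, walkClass_mul_idemClass k x hn, idemClass_mul_walkClass k i x hn, closed]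

theorem walkClass_fullLength_mem_center (x : Γ.Occurrence) :
    walkClass k x (Γ.fullLength x.1) ∈ Subalgebra.center k (Γ.BrauerAlgebra k) := by
  classical
  have pos : 0 < Γ.fullLength x.1 := Nat.zero_lt_of_lt (Γ.one_lt_fullLength _)
  refine mem_center_of_commute
    (commute_walkClass_idemClass pos (congrArg node (Γ.succ_iterate_fullLength x))) fun y => ?_
  rw [commute_iff_eq, walkClass_mul_walkClass_one k x y pos, walkClass_one_mul_walkClass k y x pos,
    walkClass_of_fullLength_lt k (Nat.lt_succ_self _), ite_self]
  split_ifs with h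
  · subst h
    exact (walkClass_of_fullLength_lt k (Nat.lt_succ_self _)).symm
  · rfl

omit [DecidableEq P] in
theorem succ_iterate_fullLength_sub_one (x : Γ.Occurrence) :
    Γ.succ^[Γ.fullLength x.1 - 1] (Γ.succ x) = x := by
  rw [← Function.iterate_succ_apply, Nat.succ_eq_add_one,
    Nat.sub_add_cancel (Γ.one_lt_fullLength _).le, succ_iterate_fullLength]

theorem walkClass_succ_mem_center {x : Γ.Occurrence} (loop : node (Γ.succ x) = node x) :
    walkClass k (Γ.succ x) (Γ.fullLength x.1 - 1)
      ∈ Subalgebra.center k (Γ.BrauerAlgebra k) := by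
  classical
  have full : Γ.fullLength x.1 - 1 + 1 = Γ.fullLength x.1 :=
    Nat.sub_add_cancel (Γ.one_lt_fullLength _).le
  have pos : 0 < Γ.fullLength x.1 - 1 := Nat.sub_pos_of_lt (Γ.one_lt_fullLength _)
  refine mem_center_of_commute
    (commute_walkClass_idemClass pos (by rw [succ_iterate_fullLength_sub_one, loop])) fun y => ?_
  rw [commute_iff_eq, walkClass_mul_walkClass_one k _ y pos, walkClass_one_mul_walkClass k y _ pos,
    succ_iterate_fullLength_sub_one, full]
  simp only [succ_bijective.injective.eq_iff]
  by_cases h : x = y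
  · subst h
    rw [if_pos rfl, if_pos rfl]
    exact walkClass_fullLength_eq k loop
  · rw [if_neg h, if_neg (Ne.symm h)]

/-- The sum of the powers of given length of the special cycles of a vertex. -/
noncomputable def rotationSum (k : Type*) [Field k] [DecidableEq V] (v : V) (n : ℕ) :
    Γ.BrauerAlgebra k :=
  ∑ x with x.1 = v, walkClass k x n

theorem rotationSum_mem_center [DecidableEq V] {v : V} {n : ℕ} (hn : 0 < n) (hv : Γ.val v ∣ n) :
    rotationSum k v n ∈ Subalgebra.center k (Γ.BrauerAlgebra k) := by
  have closed {x : Γ.Occurrence} (hx : x ∈ Finset.univ.filter fun x => x.1 = v) :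
      Γ.succ^[n] x = x :=
    succ_iterate_eq_self_iff.2 ((Finset.mem_filter.1 hx).2 ▸ hv)
  refine mem_center_of_commute (fun i => Commute.sum_left _ _ _ fun x hx =>
    commute_walkClass_idemClass hn (congrArg node (closed hx)) i) fun y => ?_
  have left : walkClass k y 1 * rotationSum k v n
      = if y.1 = v then walkClass k y (n + 1) else 0 := by
    simp only [rotationSum, Finset.mul_sum, walkClass_one_mul_walkClass k y _ hn,
      Finset.sum_ite_eq', Finset.mem_filter, Finset.mem_univ, true_and]
    rfl
  have right : rotationSum k v n * walkClass k y 1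
      = if y.1 = v then walkClass k y (n + 1) else 0 := by
    rw [rotationSum, Finset.sum_mul, Finset.sum_congr rfl fun x hx => by
      rw [walkClass_mul_walkClass_one k x y hn, closed hx], Finset.sum_ite_eq]
    simp only [Finset.mem_filter, Finset.mem_univ, true_and]
  exact right.trans left.symm

section Coordinates

variable [DecidableEq V] {z : Γ.BrauerAlgebra k}
  (hz : z ∈ Subalgebra.center k (Γ.BrauerAlgebra k))

include hz

theorem coord_trivial_eq_of_mem_center (hconn : Γ.Connected) (i j : Γ.QuiverVertex) :
    coord k (.trivial i) z = coord k (.trivial j) z := by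
  refine hconn.eq_of_forall_node_succ (c := fun i => coord k (.trivial i) z) (fun x => ?_) i j
  rw [← coord_run_one_walkClass_one_mul, Subalgebra.mem_center_iff.1 hz,
    coord_run_one_mul_walkClass_one]

theorem coord_run_succ_of_mem_center (x : Γ.Occurrence) {n : ℕ} (pos : 0 < n)
    (lt : n + 1 < Γ.fullLength x.1) :
    coord k (.run (Γ.succ x) n pos (Nat.lt_of_succ_lt lt)) z
      = if Γ.val x.1 ∣ n then coord k (.run x n pos (Nat.lt_of_succ_lt lt)) z else 0 := by
  rw [← coord_run_succ_walkClass_one_mul x pos lt, Subalgebra.mem_center_iff.1 hz,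
    coord_run_succ_mul_walkClass_one]

theorem coord_run_eq_zero_of_not_closed {x : Γ.Occurrence} {n : ℕ} (pos lt)
    (h : node (Γ.succ^[n] x) ≠ node x) : coord k (.run x n pos lt) z = 0 := by
  rw [← coord_run_idemClass_mul, Subalgebra.mem_center_iff.1 hz, coord_run_mul_idemClass_of_ne h]

theorem coord_run_eq_of_dvd {x y : Γ.Occurrence} (hxy : x.1 = y.1) {n : ℕ} (pos : 0 < n)
    (ltx : n < Γ.fullLength x.1) (lty : n < Γ.fullLength y.1) (hn : Γ.val x.1 ∣ n) :
    coord k (.run x n pos ltx) z = coord k (.run y n pos lty) z := by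
  let c (x : Γ.Occurrence) : k :=
    if h : Γ.val x.1 ∣ n ∧ n < Γ.fullLength x.1 then coord k (.run x n pos h.2) z else 0
  have c_succ (x : Γ.Occurrence) : c (Γ.succ x) = c x := by
    by_cases h : Γ.val x.1 ∣ n ∧ n < Γ.fullLength x.1
    · obtain lt | eq := lt_or_eq_of_le (Nat.succ_le_of_lt h.2)
      · have cx : c x = coord k (.run x n pos h.2) z := dif_pos h
        have cs : c (Γ.succ x) = coord k (.run (Γ.succ x) n pos h.2) z := dif_pos h
        rw [cx, cs, coord_run_succ_of_mem_center hz x pos lt, if_pos h.1]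
      · have dvd_succ : Γ.val x.1 ∣ n + 1 := Nat.succ_eq_add_one n ▸ eq ▸ Dvd.intro_left _ rfl
        have fixed : Γ.succ x = x :=
          succ_iterate_eq_self_iff.2 ((Nat.dvd_add_right h.1).1 dvd_succ)
        rw [fixed]
    · have cx : c x = 0 := dif_neg h
      have cs : c (Γ.succ x) = 0 := dif_neg h
      rw [cx, cs]
  have cx : c x = coord k (.run x n pos ltx) z := dif_pos ⟨hn, ltx⟩
  have cy : c y = coord k (.run y n pos lty) z := dif_pos ⟨hxy ▸ hn, lty⟩
  rw [← cx, ← cy, eq_of_forall_succ c_succ hxy]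

end Coordinates

/-- The indices of a basis of the center: the identity, the sums over all rotations of the proper
powers of the special cycles of a vertex, the full powers of special cycles with the arrow of a
loop removed, and the full powers of special cycles. -/
abbrev CentralIndex (Γ : BrauerConfiguration V P) : Type _ :=
  Option ((Σ v, Fin (Γ.mult v - 1)) ⊕
    {x : Γ.Occurrence // Γ.val x.1 ≠ 1 ∧ Γ.polygon (Γ.succ x) = Γ.polygon x} ⊕ Γ.QuiverVertex)

omit [DecidableEq P] in
theorem succ_mul_val_lt {v : V} (t : Fin (Γ.mult v - 1)) :
    (t + 1) * Γ.val v < Γ.fullLength v :=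
  Nat.mul_lt_mul_of_pos_right (Nat.add_lt_of_lt_sub t.2) (val_pos v)

omit [DecidableEq P] in
theorem fullLength_sub_one_lt (x : Γ.Occurrence) :
    Γ.fullLength x.1 - 1 < Γ.fullLength (Γ.succ x).1 :=
  Nat.sub_one_lt_of_lt (Γ.one_lt_fullLength _)

/-- A normal form that determines the coefficient of a central element at a given index. -/
noncomputable def pivot (i₀ : Γ.QuiverVertex) : CentralIndex Γ → NormalForm Γ
  | none => .trivial i₀
  | some (.inl ⟨v, t⟩) => .run (Γ.vertexOcc v) ((t + 1) * Γ.val v)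
      (Nat.mul_pos t.1.succ_pos (val_pos v)) (by rw [vertexOcc_fst]; exact succ_mul_val_lt t)
  | some (.inr (.inl ⟨x, _⟩)) => .run (Γ.succ x) (Γ.fullLength x.1 - 1)
      (Nat.sub_pos_of_lt (Γ.one_lt_fullLength x.1))
      (fullLength_sub_one_lt x)
  | some (.inr (.inr i)) => .socle i

variable [DecidableEq V]

variable (k) in
/-- The central element with a given index. -/
noncomputable def centralElement : CentralIndex Γ → Γ.BrauerAlgebra k
  | none => 1
  | some (.inl ⟨v, t⟩) => rotationSum k v ((t + 1) * Γ.val v)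
  | some (.inr (.inl ⟨x, _⟩)) => walkClass k (Γ.succ x) (Γ.fullLength x.1 - 1)
  | some (.inr (.inr i)) => walkClass k (polygonOcc i) (Γ.fullLength (polygonOcc i).1)

theorem centralElement_mem_center (a : CentralIndex Γ) :
    centralElement k a ∈ Subalgebra.center k (Γ.BrauerAlgebra k) := by
  obtain _ | ⟨v, t⟩ | x | i := a
  · exact one_mem _
  · exact rotationSum_mem_center (Nat.mul_pos t.1.succ_pos (val_pos v)) (Dvd.intro_left _ rfl)
  · exact walkClass_succ_mem_center x.2.2
  · exact walkClass_fullLength_mem_center _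

theorem coord_rotationSum_trivial (i : Γ.QuiverVertex) (v : V) {n : ℕ} (hn : 0 < n) :
    coord k (.trivial i) (rotationSum k v n) = 0 := by
  simp only [rotationSum, map_sum, coord_walkClass_trivial i _ hn, Finset.sum_const_zero]

theorem coord_rotationSum_run (y : Γ.Occurrence) (m : ℕ) (pos lt) (v : V) {n : ℕ} (hn : 0 < n) :
    coord k (.run y m pos lt) (rotationSum k v n) = if y.1 = v ∧ n = m then 1 else 0 := by
  simp only [rotationSum, map_sum, coord_walkClass_run y m pos lt _ hn, ite_and,
    Finset.sum_ite_eq', Finset.mem_filter, Finset.mem_univ, true_and]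

theorem coord_rotationSum_socle (i : Γ.QuiverVertex) {v : V} {n : ℕ} (hn : 0 < n)
    (lt : n < Γ.fullLength v) : coord k (.socle i) (rotationSum k v n) = 0 := by
  rw [rotationSum, map_sum]
  refine Finset.sum_eq_zero fun x hx => ?_
  rw [coord_walkClass_socle i x hn, (Finset.mem_filter.1 hx).2, if_neg fun h => lt.ne h.2]

omit [DecidableEq P] [DecidableEq V] in
theorem not_val_dvd_fullLength_sub_one {v : V} (hv : Γ.val v ≠ 1) :
    ¬ Γ.val v ∣ Γ.fullLength v - 1 := fun h =>
  hv <| Nat.dvd_one.1 <| (Nat.dvd_add_right h).1 <|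
    (Nat.sub_add_cancel (Γ.one_lt_fullLength v).le).symm ▸ Dvd.intro_left _ rfl

section Pivot

variable (i₀ : Γ.QuiverVertex) [DecidableEq (CentralIndex Γ)]

theorem coord_pivot_one (a : CentralIndex Γ) :
    coord k (pivot i₀ a) 1 = if a = none then 1 else 0 := by
  obtain _ | ⟨v, t⟩ | ⟨x, hx⟩ | i := a
  · exact (coord_one_trivial i₀).trans (if_pos rfl).symm
  · exact (coord_one_run _ _ _ _).trans (if_neg (Option.some_ne_none _)).symm
  · exact (coord_one_run _ _ _ _).trans (if_neg (Option.some_ne_none _)).symm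
  · exact (coord_one_socle i).trans (if_neg (Option.some_ne_none _)).symm

theorem coord_pivot_rotationSum (v : V) (t : Fin (Γ.mult v - 1)) (a : CentralIndex Γ) :
    coord k (pivot i₀ a) (rotationSum k v ((t + 1) * Γ.val v))
      = if a = some (.inl ⟨v, t⟩) then 1 else 0 := by
  have pos : 0 < (t + 1) * Γ.val v := Nat.mul_pos t.1.succ_pos (val_pos v)
  obtain _ | ⟨w, s⟩ | ⟨x, hx⟩ | i := a
  · exact (coord_rotationSum_trivial i₀ v pos).trans (if_neg nofun).symm
  · rw [pivot, coord_rotationSum_run _ _ _ _ v pos, vertexOcc_fst]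
    by_cases hvw : w = v
    · subst hvw
      simp [Fin.ext_iff, (val_pos w).ne', eq_comm]
    · simp [hvw]
  · rw [pivot, coord_rotationSum_run _ _ _ _ v pos, if_neg, if_neg nofun]
    rintro ⟨rfl, h⟩
    exact not_val_dvd_fullLength_sub_one hx.1 (h ▸ Dvd.intro_left _ rfl)
  · exact (coord_rotationSum_socle i pos (succ_mul_val_lt t)).trans (if_neg nofun).symm

theorem coord_pivot_walkClass_succ (x : Γ.Occurrence)
    (hx : Γ.val x.1 ≠ 1 ∧ Γ.polygon (Γ.succ x) = Γ.polygon x) (a : CentralIndex Γ) :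
    coord k (pivot i₀ a) (walkClass k (Γ.succ x) (Γ.fullLength x.1 - 1))
      = if a = some (.inr (.inl ⟨x, hx⟩)) then 1 else 0 := by
  have pos : 0 < Γ.fullLength x.1 - 1 := Nat.sub_pos_of_lt (Γ.one_lt_fullLength _)
  obtain _ | ⟨v, t⟩ | ⟨y, hy⟩ | i := a
  · exact (coord_walkClass_trivial i₀ _ pos).trans (if_neg nofun).symm
  · rw [pivot, coord_walkClass_run _ _ _ _ _ pos, if_neg, if_neg nofun]
    rintro ⟨hv, h⟩
    obtain rfl : x.1 = v := (congrArg Sigma.fst hv).trans (vertexOcc_fst v)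
    exact not_val_dvd_fullLength_sub_one hx.1 (h ▸ Dvd.intro_left _ rfl)
  · rw [pivot, coord_walkClass_run _ _ _ _ _ pos]
    by_cases hxy : y = x
    · subst hxy
      simp
    · simp [succ_bijective.injective.eq_iff, hxy, Ne.symm hxy]
  · rw [pivot, coord_walkClass_socle i _ pos, if_neg, if_neg nofun]
    exact fun h => (fullLength_sub_one_lt x).ne h.2

theorem coord_pivot_walkClass_fullLength (x : Γ.Occurrence) (a : CentralIndex Γ) :
    coord k (pivot i₀ a) (walkClass k x (Γ.fullLength x.1))
      = if a = some (.inr (.inr (node x))) then 1 else 0 := by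
  have pos : 0 < Γ.fullLength x.1 := Nat.zero_lt_of_lt (Γ.one_lt_fullLength _)
  obtain _ | ⟨v, t⟩ | ⟨y, hy⟩ | i := a
  · exact (coord_walkClass_trivial i₀ x pos).trans (if_neg nofun).symm
  · rw [pivot, coord_walkClass_run _ _ _ _ _ pos, if_neg, if_neg nofun]
    rintro ⟨rfl, h⟩
    rw [vertexOcc_fst] at h
    exact (succ_mul_val_lt t).ne h.symm
  · rw [pivot, coord_walkClass_run _ _ _ _ _ pos, if_neg, if_neg nofun]
    rintro ⟨rfl, h⟩
    exact (fullLength_sub_one_lt y).ne h.symm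
  · rw [pivot, coord_walkClass_socle i x pos]
    simp [eq_comm]

theorem coord_pivot_centralElement (a b : CentralIndex Γ) :
    coord k (pivot i₀ a) (centralElement k b) = if a = b then 1 else 0 := by
  obtain _ | ⟨v, t⟩ | ⟨x, hx⟩ | i := b
  · exact coord_pivot_one i₀ a
  · exact coord_pivot_rotationSum i₀ v t a
  · exact coord_pivot_walkClass_succ i₀ x hx a
  · rw [centralElement, coord_pivot_walkClass_fullLength, node_polygonOcc]

end Pivot

theorem coord_eq_zero_of_forall_pivot (hconn : Γ.Connected) {i₀ : Γ.QuiverVertex}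
    {z : Γ.BrauerAlgebra k} (hz : z ∈ Subalgebra.center k (Γ.BrauerAlgebra k))
    (h : ∀ a, coord k (pivot i₀ a) z = 0) (b : NormalForm Γ) : coord k b z = 0 := by
  cases b with
  | trivial i => exact (coord_trivial_eq_of_mem_center hz hconn i i₀).trans (h none)
  | socle i => exact h (some (.inr (.inr i)))
  | run x n pos lt =>
    by_cases dvd : Γ.val x.1 ∣ n
    · obtain ⟨t, rfl⟩ := exists_eq_mul_left_of_dvd dvd
      obtain ⟨t, rfl⟩ := Nat.exists_eq_add_of_le' (Nat.pos_of_mul_pos_right pos)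
      have ht : t < Γ.mult x.1 - 1 := Nat.lt_sub_of_add_lt (Nat.lt_of_mul_lt_mul_right lt)
      exact (coord_run_eq_of_dvd hz (vertexOcc_fst x.1).symm pos lt _ dvd).trans
        (h (some (.inl ⟨x.1, t, ht⟩)))
    · obtain ⟨w, rfl⟩ := succ_bijective.surjective x
      obtain lt' | eq := lt_or_eq_of_le (Nat.succ_le_of_lt lt)
      · exact (coord_run_succ_of_mem_center hz w pos lt').trans (if_neg dvd)
      · obtain rfl : n = Γ.fullLength w.1 - 1 := Nat.eq_sub_of_add_eq eq
        by_cases loop : node (Γ.succ w) = node w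
        · have hval : Γ.val w.1 ≠ 1 := fun h1 =>
            dvd (show Γ.val w.1 ∣ _ by rw [h1]; exact one_dvd _)
          exact h (some (.inr (.inl ⟨w, hval, loop⟩)))
        · refine coord_run_eq_zero_of_not_closed hz pos lt ?_
          rw [succ_iterate_fullLength_sub_one]
          exact Ne.symm loop

/-- The coefficients of a central element. -/
noncomputable def centerCoord (k : Type*) [Field k] (i₀ : Γ.QuiverVertex) :
    Subalgebra.center k (Γ.BrauerAlgebra k) →ₗ[k] CentralIndex Γ → k :=
  LinearMap.pi fun a => coord k (pivot i₀ a) ∘ₗ (Subalgebra.center k _).val.toLinearMap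

theorem centerCoord_bijective (hconn : Γ.Connected) (i₀ : Γ.QuiverVertex) :
    Function.Bijective (centerCoord k i₀) := by
  constructor
  · refine (injective_iff_map_eq_zero _).2 fun z hz => Subtype.ext <| coordinates_injective k ?_
    ext b
    rw [ZeroMemClass.coe_zero, map_zero]
    exact coord_eq_zero_of_forall_pivot hconn z.2 (congrFun hz) b
  · classical
    rw [← LinearMap.range_eq_top, eq_top_iff, ← (Pi.basisFun k (CentralIndex Γ)).span_eq,
      Submodule.span_le]
    rintro _ ⟨b, rfl⟩
    refine ⟨⟨centralElement k b, centralElement_mem_center b⟩, funext fun a => ?_⟩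
    rw [Pi.basisFun_apply, Pi.single_apply]
    exact coord_pivot_centralElement i₀ a b

end Center

section Dimension

variable {V P : Type*} [Fintype V] [Fintype P] {Γ : BrauerConfiguration V P}

theorem sum_mult_sub_one (hmult : ∀ v, Γ.mult v = if Γ.val v = 1 then 2 else 1) :
    ∑ v, (Γ.mult v - 1) = (Finset.univ.filter fun v => Γ.val v = 1).card := by
  rw [Finset.card_filter]
  refine Finset.sum_congr rfl fun v _ => ?_
  rw [hmult]
  split_ifs <;> rfl

variable (hfreq : ∀ i v, 0 < Γ.freq i v → Γ.freq i v = 1)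

include hfreq

theorem eq_of_vertex_eq_of_polygon_eq {x y : Γ.Occurrence} (vertex : x.1 = y.1)
    (polygon : Γ.polygon x = Γ.polygon y) : x = y := by
  obtain ⟨v, i, a⟩ := x
  obtain ⟨w, j, b⟩ := y
  obtain rfl : v = w := vertex
  obtain rfl : i = j := polygon
  have : Subsingleton (Fin (Γ.freq i v)) := Fin.subsingleton_iff_le_one.2 (hfreq i v a.pos).le
  rw [Subsingleton.elim a b]

theorem polygon_succ_ne {x : Γ.Occurrence} (hval : Γ.val x.1 ≠ 1) :
    Γ.polygon (Γ.succ x) ≠ Γ.polygon x := fun h =>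
  have fixed : Γ.succ x = x := eq_of_vertex_eq_of_polygon_eq hfreq rfl h
  hval (Nat.dvd_one.1 (succ_iterate_eq_self_iff.1 fixed))

end Dimension

end BrauerConfiguration

theorem proposition3p4_general {k V P : Type*} [Field k] [Fintype V] [Fintype P] [DecidableEq P]
    (Γ : BrauerConfiguration V P) (hconn : Γ.Connected) :
    Module.finrank k (Subalgebra.center k (Γ.BrauerAlgebra k))
      = 1 + Fintype.card P + ∑ v, (Γ.mult v - 1)
        + (Finset.univ.filter fun x : Γ.Occurrence =>
            Γ.val x.1 ≠ 1 ∧ Γ.polygon (Γ.succ x) = Γ.polygon x).card := by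
  classical
  obtain ⟨i₀⟩ := hconn.nonempty
  have card_vertex : Fintype.card Γ.QuiverVertex = Fintype.card P := rfl
  have bijective := BrauerConfiguration.centerCoord_bijective (k := k) hconn i₀
  rw [(LinearEquiv.ofBijective _ bijective).finrank_eq,
    Module.finrank_fintype_fun_eq_card, Fintype.card_option, Fintype.card_sum, Fintype.card_sum,
    Fintype.card_sigma, Fintype.card_subtype, card_vertex]
  simp only [Fintype.card_fin]
  ring

theorem proposition3p4 {k V P : Type*} [Field k] [Fintype V] [Fintype P] [DecidableEq P]
    (Γ : BrauerConfiguration V P) (m n : ℕ)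
    (hconn : Γ.Connected)
    (hmult : ∀ v, Γ.mult v = if Γ.val v = 1 then 2 else 1)
    (hfreq : ∀ i v, 0 < Γ.freq i v → Γ.freq i v = 1)
    (hm : Fintype.card P = m)
    (hn : (Finset.univ.filter fun v => Γ.val v = 1).card = n) :
    Module.finrank k (Subalgebra.center k (Γ.BrauerAlgebra k)) = m + n + 1 := by
  rw [proposition3p4_general Γ hconn, BrauerConfiguration.sum_mult_sub_one hmult, hn, hm,
    Finset.filter_false_of_mem fun x _ h => BrauerConfiguration.polygon_succ_ne hfreq h.1 h.2,
    Finset.card_empty]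
  ring
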